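/- Let $E(\theta,z)=\sum_{n\ge0}\theta^{n(n-1)/2}\frac{z^n}{n!}$ and let the Mallows--Riordan polynomials $J_n(\theta)\in\mathbb Z[\theta]$, $n\ge1$, be defined by the identity of formal power series in $z$ $$\log E(\theta,z)=\sum_{n\ge1}(\theta-1)^{n-1}J_n(\theta)\,\frac{z^n}{n!}.$$ Define $\widetilde J_{n+1}(\theta)$, $n\ge0$, by the identity of formal power series $$\sum_{n\ge0}\widetilde J_{n+1}(\theta)\,\frac{z^n}{n!}=\Bigl(\sum_{n\ge0}(-1)^nJ_{n+1}(\theta)\,\frac{z^n}{n!}\Bigr)^{-1}.$$ Then the $J_n$ and the $\widetilde J_{n+1}$ are indeed polynomials in $\theta$ with integer coefficients, and $\widetilde J_1=1$. For every $n\ge1$, $\widetilde J_{n+1}$ has degree $n(n-1)/2$ and valuation (lowest exponent with nonzero coefficient) $n-1$, and the coefficient of $\theta^k$ in $(-1)^{n-1}\widetilde J_{n+1}(\theta)$ is positive for every $n-1\le k\le n(n-1)/2$; so the coefficients of $\widetilde J_{n+1}$ have constant sign, which alternates with $n$. Moreover, let $X_1,X_2,\dots$ be independent random variables, uniformly distributed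 on $[-1,1]$, let $\theta\le-1$ be real, put $Y_0=0$ and $Y_n=\theta Y_{n-1}+X_n$ for $n\ge1$, and let $p_n^U(\theta)=\mathbb P[Y_1\ge0,\dots,Y_n\ge0]$ (so $p_0^U(\theta)=1$). Then for all $n\ge0$ $$p_n^U(\theta)=\frac{\widetilde J_{n+1}(1/\theta)}{2^n\,n!}.$$ -/

import Mathlib

open MeasureTheory ProbabilityTheory

namespace PersistenceAR

noncomputable section

/-- The field `ℚ(θ)` of rational functions in one variable `θ`. -/
abbrev RatF : Type := RatFunc ℚ

/-- An integer polynomial in `θ`, viewed as an element of `ℚ(θ)`. -/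
def toRatF (p : Polynomial ℤ) : RatF := Polynomial.aeval (RatFunc.X : RatF) p

/-- The deformed exponential `E(θ, z) = ∑_{n ≥ 0} θ^{n(n-1)/2} z^n / n!`, a formal power series
in `z` over `ℚ(θ)`. -/
def deformedExp : PowerSeries RatF :=
  PowerSeries.mk fun n => (RatFunc.X : RatF) ^ (n * (n - 1) / 2) / (n.factorial : RatF)

/-- The Mallows-Riordan polynomial `J_n(θ)` for `n ≥ 1`, as an element of `ℚ(θ)`: it is determined
by `log E(θ, z) = ∑_{n ≥ 1} (θ - 1)^{n-1} J_n(θ) z^n / n!`. (The value at `n = 0` is not used.) -/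
def mallowsRiordan (n : ℕ) : RatF :=
  (n.factorial : RatF) * PowerSeries.coeff n (PowerSeries.logOf deformedExp)
    / ((RatFunc.X : RatF) - 1) ^ (n - 1)

/-- The autoregressive sequence `Y_0 = 0`, `Y_n = θ Y_{n-1} + X_n`, where the innovation `X_n`,
`n ≥ 1`, is the variable `X (n - 1)`. -/
def arProcess {Ω : Type*} (θ : ℝ) (X : ℕ → Ω → ℝ) : ℕ → Ω → ℝ
  | 0 => fun _ => 0
  | n + 1 => fun ω => θ * arProcess θ X n ω + X n ω

/-- The persistence probability `p_n(θ) = P[Y_1 ≥ 0, …, Y_n ≥ 0]`. -/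
def persistenceProb {Ω : Type*} [MeasurableSpace Ω] (P : Measure Ω) (θ : ℝ) (X : ℕ → Ω → ℝ)
    (n : ℕ) : ℝ :=
  P.real {ω | ∀ k : ℕ, 1 ≤ k → k ≤ n → 0 ≤ arProcess θ X k ω}

/-- `X_1, X_2, …` are independent random variables, each uniform on `[-1, 1]`. -/
structure IsUniformInnovations {Ω : Type*} [MeasurableSpace Ω] (P : Measure Ω)
    (X : ℕ → Ω → ℝ) : Prop where
  measurable : ∀ i, Measurable (X i)
  indep : iIndepFun X P
  uniform : ∀ i, pdf.IsUniform (X i) (Set.Icc (-1 : ℝ) 1) P volume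

end

end PersistenceAR

namespace PersistenceAR

/-! Everything rests on the rule `E'(z) = E(qz)`, primes being derivatives in `z`, with `q` in place
of `θ` on the algebraic side. It gives `(log E)' = E(qz) / E(z)`. Since `(θ - 1)^n = (-1)^n (1 -
θ)^n`, replacing `z` by `z / (1 - q)` turns this quotient into the series of the `(-1)^n J_{n+1}`.
The series of the `J̃_{n+1}` is therefore `F(z) = E(z / (1 - q)) / E(qz / (1 - q))`, which is
`qQuot`.

The same rule gives `F(qz) F'(z) = (F(qz) - q F(z)) / (1 - q)` (`qQuot_functional_equation`).
Comparing coefficients yields a quadratic recursion over `ℤ[q]`. Once signs are stripped, all its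
terms have nonnegative coefficients, so integrality, support and positivity follow by induction.

For the probability, put `q = 1/θ` and let `v_n(x) / 2^n = P[Y_1, …, Y_n ≥ 0, Y_n ≤ x]` on `[0, 1]`.
Conditioning on the last step gives `v_{n+1}(x) = ∫ y in 0..x, v_n(-q (1 - y))`. The generating
function `E((x + q / (1 - q)) z) / E(qz / (1 - q))` solves this recursion and equals `F` at `x = 1`.
-/

open PowerSeries in
theorem derivative_rescale {R : Type*} [CommRing R] (a : R) (f : PowerSeries R) :
    PowerSeries.derivative R (rescale a f) = C a * rescale a (PowerSeries.derivative R f) := by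
  ext n
  simp only [coeff_derivative, coeff_rescale, coeff_C_mul]
  ring

/-! ### The deformed exponential and its quotient -/

section DeformedExponential

open PowerSeries

variable {K : Type*} [Field K]

/-- The deformed exponential `∑ q^{n(n-1)/2} z^n / n!` over a field. -/
noncomputable def qExp (q : K) : PowerSeries K :=
  PowerSeries.mk fun n => q ^ (n * (n - 1) / 2) / (n.factorial : K)

theorem succ_mul_half (n : ℕ) : (n + 1) * (n + 1 - 1) / 2 = n + n * (n - 1) / 2 := by
  have := Nat.triangle_succ n
  omega

theorem constantCoeff_qExp (q : K) : constantCoeff (qExp q) = 1 := by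
  rw [← coeff_zero_eq_constantCoeff_apply, qExp, coeff_mk]
  simp

theorem constantCoeff_rescale_qExp (q a : K) : constantCoeff (rescale a (qExp q)) = 1 := by
  rw [← coeff_zero_eq_constantCoeff_apply, coeff_rescale, coeff_zero_eq_constantCoeff_apply,
    constantCoeff_qExp]
  simp

theorem rescale_qExp_ne_zero (q a : K) : rescale a (qExp q) ≠ 0 := by
  intro h
  have := constantCoeff_rescale_qExp q a
  rw [h] at this
  simp at this

theorem derivative_qExp [CharZero K] (q : K) :
    PowerSeries.derivative K (qExp q) = rescale q (qExp q) := by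
  ext n
  have h1 : (n.factorial : K) ≠ 0 := Nat.cast_ne_zero.mpr n.factorial_ne_zero
  have h2 : (n + 1 : K) ≠ 0 := Nat.cast_add_one_ne_zero n
  simp only [coeff_derivative, coeff_rescale, qExp, coeff_mk, succ_mul_half, Nat.factorial_succ]
  push_cast
  field_simp
  ring

/-- The quotient `E(q, z / (1 - q)) / E(q, q z / (1 - q))` of deformed exponentials. -/
noncomputable def qQuot (q : K) : PowerSeries K :=
  rescale (1 - q)⁻¹ (qExp q) * (rescale (q * (1 - q)⁻¹) (qExp q))⁻¹

theorem qQuot_mul (q : K) :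
    qQuot q * rescale (q * (1 - q)⁻¹) (qExp q) = rescale (1 - q)⁻¹ (qExp q) := by
  rw [qQuot, mul_assoc, PowerSeries.inv_mul_cancel, mul_one]
  rw [constantCoeff_rescale_qExp]
  exact one_ne_zero

theorem constantCoeff_qQuot (q : K) : constantCoeff (qQuot q) = 1 := by
  have := congrArg constantCoeff (qQuot_mul q)
  simpa only [map_mul, constantCoeff_rescale_qExp, mul_one] using this

/-- With `a = 1 / (1 - q)`, differentiate `F(z) E(qaz) = E(az)` and multiply by `F(qz)`. The
relation `F(qz) E(q²az) = E(qaz)` then makes `E(qaz)` a common factor, which cancels. -/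
theorem qQuot_functional_equation [CharZero K] (q : K) :
    rescale q (qQuot q) * PowerSeries.derivative K (qQuot q) =
      C (1 - q)⁻¹ * (rescale q (qQuot q) - C q * qQuot q) := by
  set a := (1 - q)⁻¹ with ha
  have h1 := qQuot_mul q
  have h2 := congrArg (PowerSeries.derivative K) h1
  have h3 := congrArg (rescale q) h1
  rw [Derivation.leibniz, derivative_rescale, derivative_rescale, derivative_qExp] at h2
  rw [map_mul] at h3
  simp only [rescale_rescale, ← ha, smul_eq_mul] at h1 h2 h3
  rw [map_mul] at h2
  rw [show q * a * q = q * (q * a) by ring, mul_comm a q] at h3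
  apply mul_right_cancel₀ (rescale_qExp_ne_zero q (q * a))
  linear_combination (rescale q (qQuot q)) * h2 - C q * C a * qQuot q * h3

end DeformedExponential
-- The quadratic recursion over the integers
open Polynomial in
/-- The polynomials `(-1)^{n+1} J̃_{n+1}`, defined by their recursion. -/
noncomputable def signlessJt : ℕ → ℤ[X]
  | 0 => -1
  | 1 => 1
  | n + 2 => (∑ i ∈ Finset.range (n + 1), X ^ (i + 1)) * signlessJt (n + 1) +
      ∑ k : Fin n, C ((n + 1).choose (k + 1) : ℤ) * X ^ (k.val + 1) * signlessJt (k + 1) *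
        signlessJt (n + 1 - k)

/-- The polynomial `J̃_{n+1}`. -/
noncomputable def shiftedJt (n : ℕ) : Polynomial ℤ := (-1) ^ (n + 1) * signlessJt n

theorem shiftedJt_zero : shiftedJt 0 = 1 := by simp [shiftedJt, signlessJt]

theorem shiftedJt_one : shiftedJt 1 = 1 := by simp [shiftedJt, signlessJt]

open Polynomial in
theorem shiftedJt_add_two (n : ℕ) :
    shiftedJt (n + 2) = -(∑ i ∈ Finset.range (n + 1), X ^ (i + 1)) * shiftedJt (n + 1) -
      ∑ k ∈ Finset.range n, C ((n + 1).choose (k + 1) : ℤ) * X ^ (k + 1) * shiftedJt (k + 1) *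
        shiftedJt (n + 1 - k) := by
  rw [shiftedJt, signlessJt, Finset.sum_range (n := n), mul_add, sub_eq_add_neg]
  congr 1
  · rw [shiftedJt]; ring
  · rw [Finset.mul_sum, ← Finset.sum_neg_distrib]
    refine Finset.sum_congr rfl fun k _ => ?_
    have h : (-1 : ℤ[X]) ^ (n + 2 + 1) = -((-1) ^ (k.val + 1 + 1) * (-1) ^ (n + 1 - k.val + 1)) := by
      rw [← pow_add, show k.val + 1 + 1 + (n + 1 - k.val + 1) = n + 2 + 1 + 1 by omega, pow_succ _ (n + 2 + 1)]
      ring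
    rw [shiftedJt, shiftedJt, h]
    ring

section Coefficients

open PowerSeries

variable {K : Type*} [Field K] [CharZero K]

theorem factorial_cast_ne_zero (n : ℕ) : (n.factorial : K) ≠ 0 :=
  Nat.cast_ne_zero.mpr n.factorial_ne_zero

theorem qQuot_recurrence (q : K) (n : ℕ) :
    ∑ k ∈ Finset.range (n + 1), (n.choose k : K) * q ^ k * (k.factorial * coeff k (qQuot q)) *
        ((n + 1 - k).factorial * coeff (n + 1 - k) (qQuot q)) =
      (1 - q)⁻¹ * (q ^ n - q) * (n.factorial * coeff n (qQuot q)) := by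
  have h := congrArg (coeff n) (qQuot_functional_equation q)
  rw [coeff_mul, Finset.Nat.sum_antidiagonal_eq_sum_range_succ_mk, coeff_C_mul, map_sub,
    coeff_C_mul, coeff_rescale] at h
  rw [show (1 - q)⁻¹ * (q ^ n - q) * (n.factorial * coeff n (qQuot q)) = n.factorial *
    ((1 - q)⁻¹ * (q ^ n * coeff n (qQuot q) - q * coeff n (qQuot q))) by ring, ← h, Finset.mul_sum]
  refine Finset.sum_congr rfl fun k hk => ?_
  have hk : k ≤ n := Nat.lt_succ_iff.mp (Finset.mem_range.mp hk)
  simp only [coeff_rescale, coeff_derivative]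
  rw [← Nat.choose_mul_factorial_mul_factorial hk, show n + 1 - k = n - k + 1 by omega,
    Nat.factorial_succ]
  push_cast
  ring

theorem factorial_mul_coeff_qQuot (q : K) (hq : q ≠ 1) (n : ℕ) :
    n.factorial * coeff n (qQuot q) = Polynomial.aeval q (shiftedJt n) := by
  have hq' : 1 - q ≠ 0 := sub_ne_zero.mpr hq.symm
  have h0 : ((0 : ℕ).factorial : K) * coeff 0 (qQuot q) = 1 := by
    rw [coeff_zero_eq_constantCoeff_apply, constantCoeff_qQuot]; simp
  have h1 : ((1 : ℕ).factorial : K) * coeff 1 (qQuot q) = 1 := by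
    have := qQuot_recurrence q 0
    rw [Finset.sum_range_one, h0] at this
    simpa [hq'] using this
  induction n using Nat.strong_induction_on with
  | _ n ih =>
    match n with
    | 0 => rw [h0, shiftedJt_zero, map_one]
    | 1 => rw [h1, shiftedJt_one, map_one]
    | n + 2 =>
      have h := qQuot_recurrence q (n + 1)
      rw [Finset.sum_range_succ', Finset.sum_range_succ, h0] at h
      -- This sum stops at `q ^ n`; the remaining term `q ^ (n + 1)` of the recursion comes from the
      -- summand `k = n + 1`, whose other factor has index `1` and equals `1`.
      have hg : (1 - q)⁻¹ * (q ^ (n + 1) - q) = - ∑ i ∈ Finset.range n, q ^ (i + 1) := by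
        simp only [pow_succ _, ← Finset.sum_mul]
        have := geom_sum_mul q n
        field_simp
        linear_combination (-q) * this
      rw [hg, show n + 1 + 1 - (n + 1) = 1 by omega, h1, ih (n + 1) (by omega)] at h
      have hs : ∑ k ∈ Finset.range n, ((n + 1).choose (k + 1) : K) * q ^ (k + 1) *
            ((k + 1).factorial * coeff (k + 1) (qQuot q)) *
            ((n + 1 + 1 - (k + 1)).factorial * coeff (n + 1 + 1 - (k + 1)) (qQuot q)) =
          ∑ k ∈ Finset.range n, ((n + 1).choose (k + 1) : K) * q ^ (k + 1) *
            Polynomial.aeval q (shiftedJt (k + 1)) *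
            Polynomial.aeval q (shiftedJt (n + 1 - k)) := by
        refine Finset.sum_congr rfl fun k hk => ?_
        have := Finset.mem_range.mp hk
        rw [show n + 1 + 1 - (k + 1) = n + 1 - k by omega, ih _ (by omega), ih _ (by omega)]
      rw [hs] at h
      rw [shiftedJt_add_two]
      simp only [map_sub, map_neg, map_mul, map_sum, map_pow, Polynomial.aeval_X, map_natCast]
      rw [Finset.sum_range_succ]
      simp only [Nat.choose_self, Nat.choose_zero_right, Nat.cast_one, pow_zero, one_mul, mul_one,
        Nat.sub_zero] at h
      linear_combination h

theorem mk_shiftedJt_eq_qQuot (q : K) (hq : q ≠ 1) :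
    PowerSeries.mk (fun n => Polynomial.aeval q (shiftedJt n) / (n.factorial : K)) = qQuot q := by
  ext n
  rw [coeff_mk, ← factorial_mul_coeff_qQuot q hq, mul_div_cancel_left₀ _ (factorial_cast_ne_zero n)]

end Coefficients

/-! ### Mallows-Riordan polynomials through the logarithmic derivative -/

section LogarithmicDerivative

open PowerSeries

theorem derivative_logOf {A : Type*} [CommRing A] [Algebra ℚ A] (f : PowerSeries A)
    (hf : constantCoeff f = 1) :
    f * PowerSeries.derivative A (logOf f) = PowerSeries.derivative A f := by
  have hs : HasSubst (f - 1) := HasSubst.of_constantCoeff_zero' (by simp [hf])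
  rw [logOf_eq, derivative_subst hs, deriv_log]
  have hm : (1 + X) * (PowerSeries.mk fun n => algebraMap ℚ A ((-1 : ℚ) ^ n)) = 1 := by
    ext n
    cases n with
    | zero => simp [add_mul]
    | succ n => simp [add_mul, coeff_succ_X_mul, pow_succ, coeff_one]
  have h := congrArg (PowerSeries.subst (f - 1)) hm
  rw [← coe_substAlgHom hs, map_mul, map_add, map_one, coe_substAlgHom hs, subst_X hs,
    add_sub_cancel] at h
  rw [← mul_assoc, h, one_mul, map_sub]
  simp

end LogarithmicDerivative

section Inverse

/-- `n!` times the coefficients of the inverse of `∑ J̃_{n+1} z^n / n!`. -/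
noncomputable def invJt : ℕ → Polynomial ℤ
  | 0 => 1
  | n + 1 => -∑ k : Fin (n + 1), Polynomial.C ((n + 1).choose (k + 1) : ℤ) * shiftedJt (k + 1) *
      invJt (n - k)

/-- The Mallows-Riordan polynomial `J_n`, `n ≥ 1`. -/
noncomputable def mrPoly (n : ℕ) : Polynomial ℤ := (-1) ^ (n - 1) * invJt (n - 1)

open PowerSeries

theorem mk_shiftedJt_mul_mk_invJt {K : Type*} [Field K] [CharZero K] (q : K) :
    PowerSeries.mk (fun n => Polynomial.aeval q (shiftedJt n) / (n.factorial : K)) *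
      PowerSeries.mk (fun n => Polynomial.aeval q (invJt n) / (n.factorial : K)) = 1 := by
  ext n
  rw [coeff_mul, Finset.Nat.sum_antidiagonal_eq_sum_range_succ_mk]
  simp only [coeff_mk]
  cases n with
  | zero => simp [shiftedJt_zero, invJt]
  | succ n =>
    rw [Finset.sum_range_succ', shiftedJt_zero, Nat.sub_zero, invJt, coeff_one,
      if_neg (Nat.succ_ne_zero n), map_neg, map_sum, Finset.sum_range, neg_div, map_one, Nat.factorial_zero,
      Nat.cast_one, div_one, one_mul, Finset.sum_div, add_neg_eq_zero]
    refine Finset.sum_congr rfl fun k _ => ?_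
    have hk : k.val + 1 ≤ n + 1 := by omega
    have h1 := factorial_cast_ne_zero (K := K) (k.val + 1)
    have h2 := factorial_cast_ne_zero (K := K) (n - k.val)
    have h3 := factorial_cast_ne_zero (K := K) (n + 1)
    have h4 := congrArg (Nat.cast (R := K)) (Nat.choose_mul_factorial_mul_factorial hk)
    rw [show n + 1 - (k.val + 1) = n - k.val by omega] at h4 ⊢
    push_cast only [Nat.cast_mul] at h4
    simp only [map_mul, map_natCast]
    rw [div_mul_div_comm, div_eq_div_iff (mul_ne_zero h1 h2) h3, ← h4]
    ring

end Inverse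

section RationalFunctions

open PowerSeries

theorem ratFuncX_ne_one : (RatFunc.X : RatF) ≠ 1 := by
  rw [← RatFunc.algebraMap_X, ← map_one (algebraMap (Polynomial ℚ) RatF)]
  intro h
  have := RatFunc.algebraMap_injective ℚ h
  simpa using congrArg (Polynomial.eval 0) this

/-- Passes between two instances of the unique `ℤ`-algebra structure on `RatF`. -/
theorem toRatF_eq_aeval (p : Polynomial ℤ) :
    toRatF p = @Polynomial.aeval ℤ RatF _ _ (Ring.toIntAlgebra _) RatFunc.X p := by
  rw [toRatF]
  congr! <;> exact Subsingleton.elim _ _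

theorem deformedExp_eq : deformedExp = qExp (RatFunc.X : RatF) := rfl

/-- Since `E(qz) = E'(z)`, this identifies the rescaled inverse of `F` with the logarithmic
derivative of `E`. -/
theorem qExp_mul_rescale_mk_invJt {K : Type*} [Field K] [CharZero K] (q : K) (hq : q ≠ 1) :
    qExp q * rescale (1 - q)
        (PowerSeries.mk (fun n => Polynomial.aeval q (invJt n) / (n.factorial : K))) =
      rescale q (qExp q) := by
  have hq' : 1 - q ≠ 0 := sub_ne_zero.mpr hq.symm
  have h1 := congrArg (rescale (1 - q)) (mk_shiftedJt_mul_mk_invJt q)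
  have h2 := congrArg (rescale (1 - q)) (qQuot_mul q)
  rw [mk_shiftedJt_eq_qQuot q hq, map_mul, map_one] at h1
  rw [map_mul, rescale_rescale, rescale_rescale, inv_mul_cancel₀ hq', mul_assoc,
    inv_mul_cancel₀ hq', mul_one, rescale_one, RingHom.id_apply] at h2
  linear_combination (rescale q (qExp q)) * h1 - rescale (1 - q)
    (PowerSeries.mk (fun n => Polynomial.aeval q (invJt n) / (n.factorial : K))) * h2

theorem mallowsRiordan_succ (n : ℕ) : mallowsRiordan (n + 1) = toRatF (mrPoly (n + 1)) := by
  have hX := ratFuncX_ne_one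
  have hX' : (RatFunc.X : RatF) - 1 ≠ 0 := sub_ne_zero.mpr hX
  have h1 := derivative_logOf (qExp (RatFunc.X : RatF)) (constantCoeff_qExp _)
  rw [derivative_qExp, ← qExp_mul_rescale_mk_invJt _ hX] at h1
  have h0 : qExp (RatFunc.X : RatF) ≠ 0 := by
    intro h
    have := constantCoeff_qExp (RatFunc.X : RatF)
    simp [h] at this
  have h2 := congrArg (coeff n) (mul_left_cancel₀ h0 h1)
  rw [coeff_derivative, coeff_rescale, coeff_mk] at h2
  have hn := factorial_cast_ne_zero (K := RatF) n
  rw [mallowsRiordan, deformedExp_eq, mrPoly, Nat.add_sub_cancel, Nat.factorial_succ,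
    div_eq_iff (pow_ne_zero _ hX'), toRatF_eq_aeval, map_mul, map_pow, map_neg, map_one]
  -- The passage from `1 - θ` to `θ - 1` produces the sign `(-1)^n` in `mrPoly`.
  rw [show (1 - RatFunc.X : RatF) = (-1) * (RatFunc.X - 1) by ring, mul_pow] at h2
  field_simp at h2
  push_cast
  linear_combination h2

theorem mk_shiftedJt_eq_inv :
    (PowerSeries.mk fun n : ℕ => toRatF (shiftedJt n) / (n.factorial : RatF)) =
      (PowerSeries.mk fun n : ℕ =>
        (-1) ^ n * toRatF (mrPoly (n + 1)) / (n.factorial : RatF))⁻¹ := by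
  have h : (PowerSeries.mk fun n : ℕ =>
        (-1) ^ n * toRatF (mrPoly (n + 1)) / (n.factorial : RatF)) =
      PowerSeries.mk fun n => toRatF (invJt n) / (n.factorial : RatF) := by
    ext n
    simp only [coeff_mk, mrPoly, Nat.add_sub_cancel, toRatF, map_mul, map_pow, map_neg, map_one,
      ← mul_assoc, ← mul_pow]
    simp
  rw [h, PowerSeries.eq_inv_iff_mul_eq_one]
  · simp only [toRatF_eq_aeval]
    exact mk_shiftedJt_mul_mk_invJt _
  · rw [← coeff_zero_eq_constantCoeff_apply, coeff_mk]
    simp [invJt, toRatF]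

end RationalFunctions
-- Support and positivity of the coefficients
section Positivity

open Polynomial

/-- The coefficients of `p` are nonnegative, and vanish outside `[a, b]`. -/
def NonnegSupportedOn (p : ℤ[X]) (a b : ℕ) : Prop :=
  ∀ k, 0 ≤ p.coeff k ∧ (p.coeff k ≠ 0 → a ≤ k ∧ k ≤ b)

theorem NonnegSupportedOn.mono {p : ℤ[X]} {a b a' b' : ℕ} (h : NonnegSupportedOn p a b)
    (ha : a' ≤ a) (hb : b ≤ b') : NonnegSupportedOn p a' b' := fun k =>
  ⟨(h k).1, fun hk => ⟨ha.trans ((h k).2 hk).1, ((h k).2 hk).2.trans hb⟩⟩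

theorem NonnegSupportedOn.add {p q : ℤ[X]} {a b : ℕ} (hp : NonnegSupportedOn p a b)
    (hq : NonnegSupportedOn q a b) : NonnegSupportedOn (p + q) a b := fun k => by
  rw [coeff_add]
  refine ⟨add_nonneg (hp k).1 (hq k).1, fun hk => ?_⟩
  by_cases h : p.coeff k = 0
  · exact (hq k).2 fun h' => hk (by rw [h, h', add_zero])
  · exact (hp k).2 h

theorem NonnegSupportedOn.sum {ι : Type*} {s : Finset ι} {f : ι → ℤ[X]} {a b : ℕ}
    (h : ∀ i ∈ s, NonnegSupportedOn (f i) a b) : NonnegSupportedOn (∑ i ∈ s, f i) a b :=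
  Finset.sum_induction f (fun p => NonnegSupportedOn p a b) (fun _ _ => NonnegSupportedOn.add)
    (fun k => by simp) h

theorem NonnegSupportedOn.mul {p q : ℤ[X]} {a b c d : ℕ} (hp : NonnegSupportedOn p a b)
    (hq : NonnegSupportedOn q c d) : NonnegSupportedOn (p * q) (a + c) (b + d) := fun k => by
  rw [coeff_mul]
  refine ⟨Finset.sum_nonneg fun x _ => mul_nonneg (hp _).1 (hq _).1, fun hk => ?_⟩
  obtain ⟨x, hx, hne⟩ := Finset.exists_ne_zero_of_sum_ne_zero hk
  have h1 := (hp _).2 (left_ne_zero_of_mul hne)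
  have h2 := (hq _).2 (right_ne_zero_of_mul hne)
  have := Finset.HasAntidiagonal.mem_antidiagonal.mp hx
  omega

theorem NonnegSupportedOn.X_pow (n : ℕ) : NonnegSupportedOn (X ^ n) n n := fun k => by
  rw [coeff_X_pow]
  split_ifs with h
  · simp [h]
  · simp

theorem NonnegSupportedOn.C_natCast (n : ℕ) : NonnegSupportedOn (C (n : ℤ)) 0 0 := fun k => by
  rw [coeff_C]
  split_ifs with h
  · simp [h]
  · simp

theorem triangle_add_le (a b : ℕ) :
    (a + 1) * (a + 1 - 1) / 2 + (b + 1) * (b + 1 - 1) / 2 ≤ (a + b + 1) * (a + b + 1 - 1) / 2 := by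
  induction b with
  | zero => simp
  | succ b ih =>
    have h1 := succ_mul_half (b + 1)
    have h2 := succ_mul_half (a + b + 1)
    rw [show a + (b + 1) + 1 = a + b + 1 + 1 by ring]
    omega

theorem le_triangle (n : ℕ) : n ≤ (n + 1) * (n + 1 - 1) / 2 := by
  rw [succ_mul_half]
  omega

/-- The upper bound for the quadratic terms is superadditivity of triangular numbers, the factor `X
^ (k + 1)` raising the `(k + 1)`-st bound to the next. The value `-1` at index `0` never enters the
recursion. -/
theorem signlessJt_nonnegSupportedOn (n : ℕ) (hn : 1 ≤ n) :
    NonnegSupportedOn (signlessJt n) (n - 1) (n * (n - 1) / 2) := by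
  induction n using Nat.strong_induction_on with
  | _ n ih =>
    match n, hn with
    | 1, _ => simpa [signlessJt] using NonnegSupportedOn.C_natCast 1
    | n + 2, _ =>
      have hT : (n + 2) * (n + 2 - 1) / 2 = _ := succ_mul_half (n + 1)
      rw [signlessJt]
      refine NonnegSupportedOn.add ?_ (NonnegSupportedOn.sum fun k _ => ?_)
      · have h1 : NonnegSupportedOn (∑ i ∈ Finset.range (n + 1), (X : ℤ[X]) ^ (i + 1)) 1 (n + 1) :=
          NonnegSupportedOn.sum fun i hi => (NonnegSupportedOn.X_pow (i + 1)).mono (by omega)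
            (Finset.mem_range.mp hi)
        exact (h1.mul (ih (n + 1) (by omega) (by omega))).mono (by omega) (by omega)
      · have h1 := ih (k + 1) (by omega) (by omega)
        have h2 := ih (n + 1 - k) (by omega) (by omega)
        have h3 := triangle_add_le (k + 1) (n - k)
        have h4 := succ_mul_half (k + 1)
        rw [show k + 1 + (n - k) + 1 = n + 2 by omega,
          show n - k.val + 1 = n + 1 - k by omega] at h3
        exact ((((NonnegSupportedOn.C_natCast _).mul (NonnegSupportedOn.X_pow _)).mul h1).mul
          h2).mono (by omega) (by omega)

/-- The linear term alone suffices: the shifts of the previous support interval by `1, …, n` cover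
the new one. -/
theorem signlessJt_coeff_pos (n : ℕ) (hn : 1 ≤ n) :
    ∀ k, n - 1 ≤ k → k ≤ n * (n - 1) / 2 → 0 < (signlessJt n).coeff k := by
  induction n, hn using Nat.le_induction with
  | base => simp [signlessJt, coeff_one]
  | succ n hn ih =>
    obtain ⟨n, rfl⟩ := Nat.exists_eq_add_of_le' hn
    intro k hk1 hk2
    rw [succ_mul_half] at hk2
    have hle := le_triangle n
    have hS := signlessJt_nonnegSupportedOn (n + 1) (by omega)
    rw [signlessJt, coeff_add, Finset.sum_mul, finsetSum_coeff]
    refine add_pos_of_pos_of_nonneg ?_ ?_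
    · have hc (i : ℕ) : (X ^ (i + 1) * signlessJt (n + 1)).coeff k =
          if i + 1 ≤ k then (signlessJt (n + 1)).coeff (k - (i + 1)) else 0 := coeff_X_pow_mul' _ _ _
      refine Finset.sum_pos' (fun i _ => ?_)
        -- With truncated subtraction, this is the least shift bringing `k` below the top degree:
        -- shift `1` if that is enough, otherwise the one landing exactly on the top degree.
        ⟨k - (n + 1) * (n + 1 - 1) / 2 - 1, Finset.mem_range.mpr (by omega), ?_⟩
      · rw [hc]
        split_ifs
        · exact (hS _).1
        · exact le_rfl
      · rw [hc, if_pos (by omega)]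
        exact ih _ (by omega) (by omega)
    · rw [finsetSum_coeff]
      refine Finset.sum_nonneg fun j _ => ?_
      exact (((((NonnegSupportedOn.C_natCast _).mul (NonnegSupportedOn.X_pow _)).mul
        (signlessJt_nonnegSupportedOn (j + 1) (by omega))).mul
        (signlessJt_nonnegSupportedOn (n + 1 - j) (by omega))) k).1

theorem neg_one_pow_mul_shiftedJt (n : ℕ) (hn : 1 ≤ n) :
    (-1) ^ (n - 1) * shiftedJt n = signlessJt n := by
  rw [shiftedJt, ← mul_assoc, ← pow_add, show n - 1 + (n + 1) = 2 * n by omega, pow_mul]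
  simp

theorem neg_one_pow_mul_coeff_shiftedJt (n : ℕ) (hn : 1 ≤ n) (k : ℕ) :
    (-1) ^ (n - 1) * (shiftedJt n).coeff k = (signlessJt n).coeff k := by
  rw [← neg_one_pow_mul_shiftedJt n hn, show (-1 : ℤ[X]) ^ (n - 1) = C ((-1) ^ (n - 1)) by simp,
    coeff_C_mul]

theorem coeff_shiftedJt_ne_zero_iff (n : ℕ) (hn : 1 ≤ n) (k : ℕ) :
    (shiftedJt n).coeff k ≠ 0 ↔ n - 1 ≤ k ∧ k ≤ n * (n - 1) / 2 := by
  have h : (shiftedJt n).coeff k ≠ 0 ↔ (signlessJt n).coeff k ≠ 0 := by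
    rw [← neg_one_pow_mul_coeff_shiftedJt n hn, mul_ne_zero_iff]
    simp
  rw [h]
  exact ⟨(signlessJt_nonnegSupportedOn n hn k).2,
    fun hk => (signlessJt_coeff_pos n hn k hk.1 hk.2).ne'⟩

theorem pred_le_triangle (n : ℕ) (hn : 1 ≤ n) : n - 1 ≤ n * (n - 1) / 2 := by
  obtain ⟨n, rfl⟩ := Nat.exists_eq_add_of_le' hn
  exact le_triangle n

theorem natDegree_shiftedJt (n : ℕ) (hn : 1 ≤ n) :
    (shiftedJt n).natDegree = n * (n - 1) / 2 := by
  refine natDegree_eq_of_le_of_coeff_ne_zero (natDegree_le_iff_coeff_eq_zero.mpr fun k hk => ?_)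
    ((coeff_shiftedJt_ne_zero_iff n hn _).mpr ⟨pred_le_triangle n hn, le_rfl⟩)
  by_contra h
  have := (coeff_shiftedJt_ne_zero_iff n hn _).mp h
  omega

theorem natTrailingDegree_shiftedJt (n : ℕ) (hn : 1 ≤ n) :
    (shiftedJt n).natTrailingDegree = n - 1 := by
  have h := (coeff_shiftedJt_ne_zero_iff n hn _).mpr ⟨le_rfl, pred_le_triangle n hn⟩
  refine le_antisymm (natTrailingDegree_le_of_ne_zero h) (le_natTrailingDegree ?_ fun k hk => ?_)
  · rintro h0
    simp [h0] at h
  · by_contra h'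
    have := (coeff_shiftedJt_ne_zero_iff n hn _).mp h'
    omega

end Positivity
-- Solving the integral recursion
section Density

open PowerSeries

/-- The generating function in `z` of the functions `qVolume q n`. -/
noncomputable def qVolumeSeries (q x : ℝ) : PowerSeries ℝ :=
  rescale (x + q * (1 - q)⁻¹) (qExp q) * (rescale (q * (1 - q)⁻¹) (qExp q))⁻¹

/-- The functions with `qVolume q 0 = 1` and `qVolume q (n + 1) x = ∫ y in 0..x, qVolume q n (-q (1 - y))`. -/
noncomputable def qVolume (q : ℝ) (n : ℕ) (x : ℝ) : ℝ := coeff n (qVolumeSeries q x)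

theorem qVolume_zero (q x : ℝ) : qVolume q 0 x = 1 := by
  rw [qVolume, coeff_zero_eq_constantCoeff_apply, qVolumeSeries, map_mul,
    constantCoeff_rescale_qExp, constantCoeff_inv, constantCoeff_rescale_qExp]
  simp

theorem qVolume_succ_at_zero (q : ℝ) (n : ℕ) : qVolume q (n + 1) 0 = 0 := by
  rw [qVolume, qVolumeSeries, zero_add, PowerSeries.mul_inv_cancel]
  · simp [coeff_one]
  · rw [constantCoeff_rescale_qExp]
    exact one_ne_zero

theorem qVolume_at_one (q : ℝ) (hq : q ≠ 1) (n : ℕ) :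
    qVolume q n 1 = Polynomial.aeval q (shiftedJt n) / n.factorial := by
  have hq' : 1 - q ≠ 0 := sub_ne_zero.mpr hq.symm
  rw [← factorial_mul_coeff_qQuot q hq, mul_div_cancel_left₀ _ (factorial_cast_ne_zero n), qVolume,
    qVolumeSeries, qQuot, show 1 + q * (1 - q)⁻¹ = (1 - q)⁻¹ by field_simp; ring]

theorem qVolume_eq_sum (q x : ℝ) (n : ℕ) :
    qVolume q n x = ∑ k ∈ Finset.range (n + 1), (x + q * (1 - q)⁻¹) ^ k * coeff k (qExp q) *
      coeff (n - k) (rescale (q * (1 - q)⁻¹) (qExp q))⁻¹ := by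
  rw [qVolume, qVolumeSeries, coeff_mul, Finset.Nat.sum_antidiagonal_eq_sum_range_succ_mk]
  simp only [coeff_rescale]

/-- The map `x ↦ -q (1 - x)` has fixed point `-q / (1 - q)`; in the coordinate `x + q / (1 - q)` it
is multiplication by `q`, which is what differentiating `E` produces. -/
theorem hasDerivAt_qVolume_succ (q : ℝ) (hq : q ≠ 1) (n : ℕ) (x : ℝ) :
    HasDerivAt (qVolume q (n + 1)) (qVolume q n (-q * (1 - x))) x := by
  have hq' : 1 - q ≠ 0 := sub_ne_zero.mpr hq.symm
  have he (k : ℕ) : coeff (k + 1) (qExp q) * (k + 1) = q ^ k * coeff k (qExp q) := by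
    rw [← coeff_derivative, derivative_qExp, coeff_rescale]
  have hx : -q * (1 - x) + q * (1 - q)⁻¹ = q * (x + q * (1 - q)⁻¹) := by
    field_simp
    ring
  rw [show qVolume q (n + 1) = _ from funext fun y => qVolume_eq_sum q y (n + 1), qVolume_eq_sum, hx]
  simp only [Finset.sum_range_succ' _ (n + 1), pow_zero, one_mul]
  refine HasDerivAt.add_const _ (HasDerivAt.fun_sum fun k _ => ?_)
  have h := ((((hasDerivAt_id x).add_const (q * (1 - q)⁻¹)).pow (k + 1)).mul_const
    (coeff (k + 1) (qExp q))).mul_const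
    (coeff (n + 1 - (k + 1)) (rescale (q * (1 - q)⁻¹) (qExp q))⁻¹)
  refine h.congr_deriv ?_
  rw [Nat.add_sub_add_right n 1 k, Nat.add_sub_cancel, mul_pow]
  simp only [id]
  push_cast
  linear_combination (x + q * (1 - q)⁻¹) ^ k *
    (coeff (n - k) (rescale (q * (1 - q)⁻¹) (qExp q))⁻¹) * he k

theorem continuous_qVolume (q : ℝ) (n : ℕ) : Continuous (qVolume q n) := by
  rw [show qVolume q n = _ from funext fun y => qVolume_eq_sum q y n]
  fun_prop

theorem qVolume_succ_eq_integral (q : ℝ) (hq : q ≠ 1) (n : ℕ) (x : ℝ) :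
    qVolume q (n + 1) x = ∫ y in (0 : ℝ)..x, qVolume q n (-q * (1 - y)) := by
  have hc : Continuous fun y => qVolume q n (-q * (1 - y)) :=
    (continuous_qVolume q n).comp (by fun_prop)
  rw [intervalIntegral.integral_eq_sub_of_hasDerivAt
    (fun y _ => hasDerivAt_qVolume_succ q hq n y) (hc.intervalIntegrable _ _),
    qVolume_succ_at_zero, sub_zero]

theorem qVolume_nonneg {q : ℝ} (hq0 : q ≤ 0) (hq1 : -1 ≤ q) (n : ℕ) :
    ∀ x ∈ Set.Icc (0 : ℝ) 1, 0 ≤ qVolume q n x := by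
  induction n with
  | zero => intro x _; rw [qVolume_zero]; exact zero_le_one
  | succ n ih =>
    intro x hx
    rw [qVolume_succ_eq_integral q (by linarith)]
    refine intervalIntegral.integral_nonneg hx.1 fun y hy => ih _ ⟨?_, ?_⟩
    · exact mul_nonneg (by linarith) (by linarith [hx.2, hy.2])
    · nlinarith [hx.2, hy.2, hy.1]

theorem lintegral_qVolume {q : ℝ} (hq0 : q ≤ 0) (hq1 : -1 ≤ q) (n : ℕ) {x : ℝ}
    (hx : x ∈ Set.Icc (0 : ℝ) 1) :
    ∫⁻ y in Set.Icc 0 x, ENNReal.ofReal (qVolume q n (-q * (1 - y)) / 2 ^ n) =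
      ENNReal.ofReal (qVolume q (n + 1) x / 2 ^ n) := by
  have hc : Continuous fun y => qVolume q n (-q * (1 - y)) / 2 ^ n :=
    ((continuous_qVolume q n).comp (by fun_prop)).div_const _
  rw [← ofReal_integral_eq_lintegral_ofReal hc.integrableOn_Icc, integral_Icc_eq_integral_Ioc,
    ← intervalIntegral.integral_of_le hx.1, intervalIntegral.integral_div,
    qVolume_succ_eq_integral q (by linarith)]
  filter_upwards [ae_restrict_mem measurableSet_Icc] with y hy
  refine div_nonneg (qVolume_nonneg hq0 hq1 n _ ⟨?_, ?_⟩) (by positivity)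
  · exact mul_nonneg (by linarith) (by linarith [hx.2, hy.2])
  · nlinarith [hx.2, hy.2, hy.1]

end Density
-- The autoregression killed when it becomes negative
section Killed

variable {Ω : Type*}

/-- The autoregressive sequence, sent to the cemetery state `-1` once it becomes negative. -/
noncomputable def killedProcess (θ : ℝ) (X : ℕ → Ω → ℝ) : ℕ → Ω → ℝ
  | 0 => fun _ => 0
  | n + 1 => fun ω => if 0 ≤ killedProcess θ X n ω ∧ 0 ≤ θ * killedProcess θ X n ω + X n ω then
      θ * killedProcess θ X n ω + X n ω else -1

theorem killedProcess_succ_mem_Icc (θ : ℝ) (X : ℕ → Ω → ℝ) (n : ℕ) (x : ℝ) (ω : Ω) :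
    killedProcess θ X (n + 1) ω ∈ Set.Icc 0 x ↔
      0 ≤ killedProcess θ X n ω ∧ θ * killedProcess θ X n ω + X n ω ∈ Set.Icc 0 x := by
  rw [killedProcess]
  simp only [Set.mem_Icc]
  split_ifs with h
  · tauto
  · norm_num
    intro h1 h2
    exact absurd ⟨h1, h2⟩ h

/-- Killing encodes the whole past event in the sign of one variable, so the induction on laws needs
only the current state. -/
theorem killedProcess_nonneg_iff (θ : ℝ) (X : ℕ → Ω → ℝ) (n : ℕ) (ω : Ω) :
    (0 ≤ killedProcess θ X n ω ↔ ∀ k : ℕ, 1 ≤ k → k ≤ n → 0 ≤ arProcess θ X k ω) ∧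
      (0 ≤ killedProcess θ X n ω → killedProcess θ X n ω = arProcess θ X n ω) := by
  induction n with
  | zero =>
    refine ⟨⟨fun _ k h1 h2 => ?_, fun _ => le_rfl⟩, fun _ => rfl⟩
    omega
  | succ n ih =>
    obtain ⟨ih1, ih2⟩ := ih
    by_cases h : 0 ≤ killedProcess θ X n ω
    · have hZ : killedProcess θ X (n + 1) ω = if 0 ≤ arProcess θ X (n + 1) ω then
          arProcess θ X (n + 1) ω else -1 := by
        simp only [killedProcess, arProcess, ← ih2 h, h, true_and]
      rw [hZ]
      split_ifs with h'
      · refine ⟨⟨fun _ k h1 h2 => ?_, fun _ => h'⟩, fun _ => rfl⟩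
        rcases Nat.lt_or_ge n k with hk | hk
        · rwa [show k = n + 1 by omega]
        · exact ih1.mp h k h1 hk
      · refine ⟨⟨fun h0 => by norm_num at h0, fun hk => ?_⟩, fun h0 => by norm_num at h0⟩
        exact absurd (hk (n + 1) (by omega) le_rfl) h'
    · have hZ : killedProcess θ X (n + 1) ω = -1 := by
        rw [killedProcess]
        exact if_neg fun h' => h h'.1
      rw [hZ]
      refine ⟨⟨fun h0 => by norm_num at h0, fun hk => ?_⟩, fun h0 => by norm_num at h0⟩
      exact absurd (ih1.mpr fun k h1 h2 => hk k h1 (by omega)) h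

/-- The state after `n` steps depends only on `X 0, …, X (n - 1)`, hence is independent of `X n`. -/
theorem measurable_killedProcess (θ : ℝ) (X : ℕ → Ω → ℝ) (n : ℕ) :
    Measurable[⨆ i ∈ Set.Iio n, MeasurableSpace.comap (X i) inferInstance]
      (killedProcess θ X n) := by
  induction n with
  | zero => exact measurable_const
  | succ n ih =>
    have h1 : Measurable[⨆ i ∈ Set.Iio (n + 1), MeasurableSpace.comap (X i) inferInstance]
        (killedProcess θ X n) :=
      ih.mono (biSup_mono fun i hi => Set.mem_Iio.mpr (Nat.lt_succ_of_lt hi)) le_rfl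
    have h2 : Measurable[⨆ i ∈ Set.Iio (n + 1), MeasurableSpace.comap (X i) inferInstance]
        (X n) :=
      (comap_measurable (X n)).mono
        (le_biSup (fun i => MeasurableSpace.comap (X i) inferInstance)
          (Set.mem_Iio.mpr n.lt_succ_self)) le_rfl
    have h3 := (h1.const_mul θ).add h2
    have h0 : Measurable[⨆ i ∈ Set.Iio (n + 1), MeasurableSpace.comap (X i) inferInstance]
      (fun _ : Ω => (0 : ℝ)) := measurable_const
    exact Measurable.ite ((measurableSet_le h0 h1).inter (measurableSet_le h0 h3)) h3
      measurable_const

variable [MeasurableSpace Ω] {P : Measure Ω} {X : ℕ → Ω → ℝ}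

theorem IsUniformInnovations.measurable_killedProcess (hX : IsUniformInnovations P X) (θ : ℝ)
    (n : ℕ) : Measurable (killedProcess θ X n) :=
  (PersistenceAR.measurable_killedProcess θ X n).mono
    (iSup₂_le fun i _ => (hX.measurable i).comap_le) le_rfl

theorem IsUniformInnovations.indepFun_killedProcess (hX : IsUniformInnovations P X) (θ : ℝ)
    (n : ℕ) : IndepFun (killedProcess θ X n) (X n) P := by
  have h := indep_iSup_of_disjoint (fun i => (hX.measurable i).comap_le) hX.indep
    (S := Set.Iio n) (T := {n}) (by simp)
  rw [iSup_singleton] at h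
  rw [IndepFun_iff_Indep]
  exact indep_of_indep_of_le_left h (PersistenceAR.measurable_killedProcess θ X n).comap_le

theorem IsUniformInnovations.map_apply (hX : IsUniformInnovations P X) (n : ℕ) (B : Set ℝ) :
    P.map (X n) B = 2⁻¹ * volume (Set.Icc (-1) 1 ∩ B) := by
  rw [hX.uniform n, cond_apply measurableSet_Icc, Real.volume_Icc]
  norm_num

theorem IsUniformInnovations.ae_le_one [IsProbabilityMeasure P] (hX : IsUniformInnovations P X)
    (n : ℕ) : ∀ᵐ ω ∂P, X n ω ≤ 1 := by
  refine ae_of_ae_map (hX.measurable n).aemeasurable (p := fun u => u ≤ 1) ?_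
  rw [ae_iff, hX.map_apply]
  convert mul_zero _
  convert measure_empty
  · ext u
    simp only [Set.mem_inter_iff, Set.mem_Icc, Set.mem_ofPred_eq, Set.mem_empty_iff_false, iff_false]
    tauto
  · infer_instance

/-- The section of the transition of the autoregression, translated to the position reached. -/
theorem volume_Icc_inter_transition {θ : ℝ} (hθ : θ ≤ -1) (x z : ℝ) :
    -- Substitute `u = y - θ z`. As `θ ≤ 0 ≤ z` and `y ≥ 0`, the bound `-1 ≤ u` is automatic, and `u
    -- ≤ 1` becomes `z ≤ -(1 / θ) (1 - y)`.
    volume (Set.Icc (-1) 1 ∩ {u : ℝ | 0 ≤ z ∧ θ * z + u ∈ Set.Icc 0 x}) =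
      volume {y : ℝ | y ∈ Set.Icc 0 x ∧ z ∈ Set.Icc 0 (-(1 / θ) * (1 - y))} := by
  rw [← measure_preimage_add volume (-(θ * z))]
  congr 1
  ext y
  simp only [Set.mem_preimage, Set.mem_inter_iff, Set.mem_Icc, Set.mem_ofPred_eq]
  rw [show -(1 / θ) * (1 - y) = (1 - y) / (-θ) by field_simp, le_div_iff₀ (by linarith)]
  constructor
  · rintro ⟨⟨h1, h2⟩, h3, h4, h5⟩
    refine ⟨⟨by linarith, by linarith⟩, h3, by linarith⟩
  · rintro ⟨⟨h1, h2⟩, h3, h4⟩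
    refine ⟨⟨by nlinarith, by linarith⟩, h3, by linarith, by linarith⟩

theorem IsUniformInnovations.measure_killedProcess_succ [IsProbabilityMeasure P]
    (hX : IsUniformInnovations P X) {θ : ℝ} (hθ : θ ≤ -1) (n : ℕ) (x : ℝ) :
    P (killedProcess θ X (n + 1) ⁻¹' Set.Icc 0 x) =
      2⁻¹ * ∫⁻ y in Set.Icc 0 x,
        P (killedProcess θ X n ⁻¹' Set.Icc 0 (-(1 / θ) * (1 - y))) := by
  have hZ := hX.measurable_killedProcess θ n
  set ν := P.map (killedProcess θ X n) with hν
  have : IsProbabilityMeasure ν := Measure.isProbabilityMeasure_map hZ.aemeasurable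
  have : IsProbabilityMeasure (P.map (X n)) :=
    Measure.isProbabilityMeasure_map (hX.measurable n).aemeasurable
  have hS : MeasurableSet {p : ℝ × ℝ | 0 ≤ p.1 ∧ θ * p.1 + p.2 ∈ Set.Icc 0 x} :=
    (measurableSet_le measurable_const measurable_fst).inter
      ((by fun_prop : Measurable fun p : ℝ × ℝ => θ * p.1 + p.2) measurableSet_Icc)
  have hS' : MeasurableSet {p : ℝ × ℝ | p.2 ∈ Set.Icc 0 x ∧
      p.1 ∈ Set.Icc 0 (-(1 / θ) * (1 - p.2))} :=
    (measurable_snd measurableSet_Icc).inter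
      ((measurableSet_le measurable_const measurable_fst).inter
        (measurableSet_le measurable_fst (by fun_prop)))
  have h1 : P (killedProcess θ X (n + 1) ⁻¹' Set.Icc 0 x) =
      P.map (fun ω => (killedProcess θ X n ω, X n ω))
        {p : ℝ × ℝ | 0 ≤ p.1 ∧ θ * p.1 + p.2 ∈ Set.Icc 0 x} := by
    rw [Measure.map_apply (hZ.prodMk (hX.measurable n)) hS]
    congr 1
    ext ω
    exact killedProcess_succ_mem_Icc θ X n x ω
  rw [h1, (hX.indepFun_killedProcess θ n).map_prod_eq_prod_map_map hZ.aemeasurable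
    (hX.measurable n).aemeasurable, Measure.prod_apply hS]
  simp only [hX.map_apply, Set.preimage_ofPred_eq, volume_Icc_inter_transition hθ]
  rw [lintegral_const_mul' _ _ (by simp)]
  congr 1
  -- Tonelli: exchange the old state `z` and the new state `y`, so that the inner measure becomes
  -- the distribution of the old state.
  have h2 := Measure.prod_apply (μ := ν) (ν := volume) hS'
  rw [Measure.prod_apply_symm hS'] at h2
  simp only [Set.preimage_ofPred_eq] at h2
  rw [← h2, ← lintegral_indicator measurableSet_Icc]
  refine lintegral_congr fun y => ?_
  by_cases hy : y ∈ Set.Icc 0 x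
  · rw [Set.indicator_of_mem hy, hν, ← Measure.map_apply hZ measurableSet_Icc]
    simp only [hy, true_and, Set.ofPred_mem_eq]
  · rw [Set.indicator_of_notMem hy]
    simp [hy]

theorem IsUniformInnovations.measure_killedProcess [IsProbabilityMeasure P]
    (hX : IsUniformInnovations P X) {θ : ℝ} (hθ : θ ≤ -1) (n : ℕ) :
    ∀ x ∈ Set.Icc (0 : ℝ) 1, P (killedProcess θ X n ⁻¹' Set.Icc 0 x) =
      ENNReal.ofReal (qVolume (1 / θ) n x / 2 ^ n) := by
  have hq0 : 1 / θ ≤ 0 := div_nonpos_of_nonneg_of_nonpos zero_le_one (by linarith)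
  have hq1 : -1 ≤ 1 / θ := by
    rw [le_div_iff_of_neg (by linarith)]
    linarith
  induction n with
  | zero =>
    intro x hx
    rw [qVolume_zero]
    have : killedProcess θ X 0 ⁻¹' Set.Icc 0 x = Set.univ :=
      Set.eq_univ_of_forall fun ω => ⟨le_rfl, hx.1⟩
    rw [this, measure_univ]
    simp
  | succ n ih =>
    intro x hx
    have h : ∫⁻ y in Set.Icc 0 x, P (killedProcess θ X n ⁻¹' Set.Icc 0 (-(1 / θ) * (1 - y))) =
        ∫⁻ y in Set.Icc 0 x, ENNReal.ofReal (qVolume (1 / θ) n (-(1 / θ) * (1 - y)) / 2 ^ n) := by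
      -- The condition `θ ≤ -1` keeps `-(1 / θ) (1 - y)` in `[0, 1]`, where the induction hypothesis
      -- applies.
      refine setLIntegral_congr_fun measurableSet_Icc fun y hy => ih _ ⟨?_, ?_⟩
      · exact mul_nonneg (by linarith) (by linarith [hx.2, hy.2])
      · nlinarith [hx.2, hy.2, hy.1]
    have h2 : (2⁻¹ : ENNReal) = ENNReal.ofReal 2⁻¹ := by
      rw [ENNReal.ofReal_inv_of_pos two_pos, ENNReal.ofReal_ofNat]
    rw [hX.measure_killedProcess_succ hθ, h, lintegral_qVolume hq0 hq1 n hx, h2,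
      ← ENNReal.ofReal_mul (by norm_num), pow_succ]
    congr 1
    field_simp

theorem IsUniformInnovations.ae_killedProcess_le_one [IsProbabilityMeasure P]
    (hX : IsUniformInnovations P X) {θ : ℝ} (hθ : θ ≤ -1) (n : ℕ) :
    ∀ᵐ ω ∂P, killedProcess θ X n ω ≤ 1 := by
  cases n with
  | zero => exact Filter.Eventually.of_forall fun ω => zero_le_one
  | succ n =>
    filter_upwards [hX.ae_le_one n] with ω hω
    simp only [killedProcess]
    split_ifs with h
    -- A surviving state is nonnegative, so `θ` times it is at most `0` and the new state is at most
    -- `X n ≤ 1`.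
    · nlinarith [h.1]
    · norm_num

theorem IsUniformInnovations.persistenceProb_eq [IsProbabilityMeasure P]
    (hX : IsUniformInnovations P X) {θ : ℝ} (hθ : θ ≤ -1) (n : ℕ) :
    persistenceProb P θ X n =
      Polynomial.aeval (1 / θ) (shiftedJt n) / (2 ^ n * (n.factorial : ℝ)) := by
  have hq0 : 1 / θ ≤ 0 := div_nonpos_of_nonneg_of_nonpos zero_le_one (by linarith)
  have hq1 : -1 ≤ 1 / θ := by
    rw [le_div_iff_of_neg (by linarith)]
    linarith
  have h1 : (1 : ℝ) ∈ Set.Icc (0 : ℝ) 1 := ⟨zero_le_one, le_rfl⟩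
  have h : P {ω | ∀ k : ℕ, 1 ≤ k → k ≤ n → 0 ≤ arProcess θ X k ω} =
      P (killedProcess θ X n ⁻¹' Set.Icc 0 1) := by
    refine measure_congr ?_
    filter_upwards [hX.ae_killedProcess_le_one hθ n] with ω hω
    refine propext ?_
    change (∀ k : ℕ, 1 ≤ k → k ≤ n → 0 ≤ arProcess θ X k ω) ↔ _ ∧ _
    rw [← (killedProcess_nonneg_iff θ X n ω).1]
    simp only [hω, and_true]
  rw [persistenceProb, Measure.real, h, hX.measure_killedProcess hθ n 1 h1,
    ENNReal.toReal_ofReal (div_nonneg (qVolume_nonneg hq0 hq1 n 1 h1) (by positivity)),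
    qVolume_at_one _ (by linarith), div_div, mul_comm (2 ^ n : ℝ)]

end Killed
end PersistenceAR

theorem corollary1 :
    ∃ J Jt : ℕ → Polynomial ℤ,
      (∀ n : ℕ, 1 ≤ n → PersistenceAR.toRatF (J n) = PersistenceAR.mallowsRiordan n) ∧
      (PowerSeries.mk fun n : ℕ =>
          PersistenceAR.toRatF (Jt (n + 1)) / (n.factorial : PersistenceAR.RatF)) =
        (PowerSeries.mk fun n : ℕ =>
          (-1) ^ n * PersistenceAR.toRatF (J (n + 1)) / (n.factorial : PersistenceAR.RatF))⁻¹ ∧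
      Jt 1 = 1 ∧
      (∀ n : ℕ, 1 ≤ n →
        (Jt (n + 1)).natDegree = n * (n - 1) / 2 ∧
        (Jt (n + 1)).natTrailingDegree = n - 1 ∧
        ∀ k : ℕ, n - 1 ≤ k → k ≤ n * (n - 1) / 2 →
          0 < (-1 : ℤ) ^ (n - 1) * (Jt (n + 1)).coeff k) ∧
      ∀ (Ω : Type*) [MeasurableSpace Ω] (P : Measure Ω) [IsProbabilityMeasure P]
        (X : ℕ → Ω → ℝ), PersistenceAR.IsUniformInnovations P X →
        ∀ θ : ℝ, θ ≤ -1 → ∀ n : ℕ,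
          PersistenceAR.persistenceProb P θ X n =
            Polynomial.aeval (1 / θ) (Jt (n + 1)) / (2 ^ n * (n.factorial : ℝ)) := by
  -- `shiftedJt n` is `J̃_{n+1}`, hence the index shift; the values at index `0` are irrelevant.
  refine ⟨PersistenceAR.mrPoly, fun n => PersistenceAR.shiftedJt (n - 1), fun n hn => ?_,
    PersistenceAR.mk_shiftedJt_eq_inv, PersistenceAR.shiftedJt_zero, fun n hn =>
      ⟨PersistenceAR.natDegree_shiftedJt n hn, PersistenceAR.natTrailingDegree_shiftedJt n hn,
        fun k h1 h2 => ?_⟩, fun Ω _ P _ X hX θ hθ n => hX.persistenceProb_eq hθ n⟩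
  · obtain ⟨n, rfl⟩ := Nat.exists_eq_add_of_le' hn
    exact (PersistenceAR.mallowsRiordan_succ n).symm
  · change 0 < (-1 : ℤ) ^ (n - 1) * (PersistenceAR.shiftedJt n).coeff k
    rw [PersistenceAR.neg_one_pow_mul_coeff_shiftedJt n hn]
    exact PersistenceAR.signlessJt_coeff_pos n hn k h1 h2
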